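/- Let $k$ be a field. All graded algebras are of the form $A=\bigoplus_{i\ge 0}A_i$ with $A_0=k$; for a graded (left or right) $A$-module $M=\bigoplus_{i\in\mathbb Z}M_i$ let $M(j)$ denote the shifted module with $M(j)_i=M_{i+j}$. A graded right $A$-module $M$ is called coherent if it is finitely generated and for every degree-preserving homomorphism $f\colon A(d_1)\oplus\dots\oplus A(d_n)\to M$ (with $n\ge 0$, $d_1,\dots,d_n\in\mathbb Z$) of graded right $A$-modules, $\ker f$ is finitely generated. The graded algebra $A$ is called right coherent if for every $j\in\mathbb Z$ the graded right $A$-modules $A(j)$ and $k(j)$ are coherent, where $k=A/A_+$ with $A_+=\bigoplus_{i>0}A_i$. Left coherence is defined in the same way with left modules. Grade the following algebras by $\deg x=\deg y=\deg z=1$. 1. The algebra $k\langle x,y,z\rangle/(xy,\;yz,\;xz-zx)$ is neither left nor right coherent. 2. The algebra $k\langle x,y,z\rangle/(yz,\;xz-zx)$ is right coherent but not left coherent. -/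

import Mathlib

/-! ### Graded modules and coherence

Modules are left modules over a `k`-algebra `R`; right modules over `A` are, as everywhere in
Mathlib, left modules over `Aᵐᵒᵖ`. -/

/-- A nonnegative grading, viewed as a grading by the integers with `R_i = 0` for `i < 0`. -/
def intGrading {k R : Type*} [CommSemiring k] [Semiring R] [Algebra k R]
    (𝒜 : ℕ → Submodule k R) : ℤ → Submodule k R
  | Int.ofNat n => 𝒜 n
  | Int.negSucc _ => ⊥

/-- The grading of the shifted module `M(j)`, where `M(j)_i = M_{i + j}`. -/
def shiftGrading {k M : Type*} [CommSemiring k] [AddCommMonoid M] [Module k M]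
    (ℳ : ℤ → Submodule k M) (j : ℤ) : ℤ → Submodule k M :=
  fun i => ℳ (i + j)

/-- `f` is a homomorphism of graded modules (it preserves degrees) from the graded free module
`R(d 0) ⊕ ⋯ ⊕ R(d (n - 1))` to the module `M` graded by `ℳ`. -/
def IsGradedHom {k R M : Type*} [Field k] [Ring R] [Algebra k R]
    [AddCommGroup M] [Module k M] [Module R M]
    (𝒜 : ℕ → Submodule k R) (ℳ : ℤ → Submodule k M)
    {n : ℕ} (d : Fin n → ℤ) (f : (Fin n → R) →ₗ[R] M) : Prop :=
  ∀ (i : ℤ) (v : Fin n → R),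
    (∀ s, v s ∈ shiftGrading (intGrading 𝒜) (d s) i) → f v ∈ ℳ i

/-- Coherence of a graded module: it is finitely generated, and so is the kernel of every
homomorphism of graded modules to it from a finite direct sum of shifts of `R`.
(A graded module that is finitely generated is generated by finitely many homogeneous elements,
so `Module.Finite` and `Submodule.FG` also express finite generation in the graded sense.) -/
def IsCoherentGradedModule {k R M : Type*} [Field k] [Ring R] [Algebra k R]
    [AddCommGroup M] [Module k M] [Module R M]
    (𝒜 : ℕ → Submodule k R) (ℳ : ℤ → Submodule k M) : Prop :=
  Module.Finite R M ∧
    ∀ (n : ℕ) (d : Fin n → ℤ) (f : (Fin n → R) →ₗ[R] M),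
      IsGradedHom 𝒜 ℳ d f → (LinearMap.ker f).FG

/-- The left ideal `R_+` generated by the homogeneous elements of positive degree. -/
def positivePart {k R : Type*} [Field k] [Ring R] [Algebra k R]
    (𝒜 : ℕ → Submodule k R) : Submodule R R :=
  Submodule.span R {a : R | ∃ n : ℕ, 0 < n ∧ a ∈ 𝒜 n}

/-- The module `R / R_+` (which is `k` if `R_0 = k`) concentrated in degree `0`. -/
def simpleGrading {k R : Type*} [Field k] [Ring R] [Algebra k R]
    (𝒜 : ℕ → Submodule k R) : ℤ → Submodule k (R ⧸ positivePart 𝒜) :=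
  fun i => if i = 0 then ⊤ else ⊥

/-- A graded algebra `R` is left coherent if all shifts of `R` and all shifts of the module
`R / R_+` are coherent graded left modules. -/
def IsGradedLeftCoherent {k R : Type*} [Field k] [Ring R] [Algebra k R]
    (𝒜 : ℕ → Submodule k R) [GradedAlgebra 𝒜] : Prop :=
  (∀ j : ℤ, IsCoherentGradedModule 𝒜 (shiftGrading (intGrading 𝒜) j)) ∧
    ∀ j : ℤ, IsCoherentGradedModule 𝒜 (shiftGrading (simpleGrading 𝒜) j)

/-- The grading of the opposite algebra. -/
def opGrading {k A : Type*} [Field k] [Ring A] [Algebra k A]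
    (𝒜 : ℕ → Submodule k A) : ℕ → Submodule k Aᵐᵒᵖ :=
  fun n => (𝒜 n).comap (MulOpposite.opLinearEquiv k).symm.toLinearMap

theorem mem_opGrading {k A : Type*} [Field k] [Ring A] [Algebra k A]
    (𝒜 : ℕ → Submodule k A) (n : ℕ) (a : Aᵐᵒᵖ) :
    a ∈ opGrading 𝒜 n ↔ a.unop ∈ 𝒜 n := Iff.rfl

noncomputable instance opGradedAlgebra {k A : Type*} [Field k] [Ring A] [Algebra k A]
    (𝒜 : ℕ → Submodule k A) [GradedAlgebra 𝒜] : GradedAlgebra (opGrading 𝒜) where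
  one_mem := SetLike.GradedOne.one_mem (A := 𝒜)
  mul_mem i j a b ha hb := by
    rw [mem_opGrading] at ha hb ⊢
    rw [add_comm, MulOpposite.unop_mul]
    exact SetLike.GradedMul.mul_mem hb ha
  toDecomposition := by
    refine DirectSum.IsInternal.chooseDecomposition _ ?_
    have h : DirectSum.IsInternal 𝒜 := DirectSum.Decomposition.isInternal 𝒜
    rw [DirectSum.isInternal_submodule_iff_iSupIndep_and_iSup_eq_top] at h ⊢
    have e : opGrading 𝒜 =
        fun n => Submodule.orderIsoMapComap (MulOpposite.opLinearEquiv (M := A) k) (𝒜 n) := by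
      funext n
      ext a
      rw [mem_opGrading]
      simp
    rw [e]
    refine ⟨h.1.map_orderIso _, ?_⟩
    rw [← OrderIso.map_iSup, h.2, OrderIso.map_top]

/-- A graded algebra `A` is right coherent if all shifts of `A` and all shifts of `A / A_+`
are coherent graded right modules. -/
def IsGradedRightCoherent {k A : Type*} [Field k] [Ring A] [Algebra k A]
    (𝒜 : ℕ → Submodule k A) [GradedAlgebra 𝒜] : Prop :=
  IsGradedLeftCoherent (opGrading 𝒜)

/-! ### Algebras given by generators and homogeneous relations -/

/-- The image of a generator in the algebra with generators `X` and relations `r`. -/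
def generatorClass {k X : Type*} [Field k]
    (r : FreeAlgebra k X → FreeAlgebra k X → Prop) (i : X) : RingQuot r :=
  RingQuot.mkAlgHom k r (FreeAlgebra.ι k i)

/-- The `n`-th graded piece when all generators have degree `1`: the span of all products
of `n` generators. -/
def wordGrading {k X : Type*} [Field k]
    (r : FreeAlgebra k X → FreeAlgebra k X → Prop) : ℕ → Submodule k (RingQuot r) :=
  fun n => Submodule.span k (Set.range (generatorClass r)) ^ n

instance wordGrading_gradedMonoid {k X : Type*} [Field k]
    (r : FreeAlgebra k X → FreeAlgebra k X → Prop) : SetLike.GradedMonoid (wordGrading r) :=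
  Submodule.nat_power_gradedMonoid _

theorem generatorClass_mem {k X : Type*} [Field k]
    (r : FreeAlgebra k X → FreeAlgebra k X → Prop) (i : X) :
    generatorClass r i ∈ wordGrading r 1 := by
  rw [wordGrading, pow_one]
  exact Submodule.subset_span ⟨i, rfl⟩

/-- The map from the free algebra to the direct sum of the graded pieces of the quotient. -/
noncomputable def freeToGraded {k X : Type*} [Field k]
    (r : FreeAlgebra k X → FreeAlgebra k X → Prop) :
    FreeAlgebra k X →ₐ[k] DirectSum ℕ (fun n => wordGrading r n) :=
  FreeAlgebra.lift k fun i =>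
    DirectSum.of (fun n => wordGrading r n) 1 ⟨generatorClass r i, generatorClass_mem r i⟩

/-- If the relations are homogeneous, the graded pieces do form a grading. -/
@[reducible] noncomputable def wordGradedAlgebra {k X : Type*} [Field k]
    (r : FreeAlgebra k X → FreeAlgebra k X → Prop)
    (h : ∀ ⦃a b⦄, r a b → freeToGraded r a = freeToGraded r b) :
    GradedAlgebra (wordGrading r) :=
  GradedAlgebra.ofAlgHom (wordGrading r) (RingQuot.liftAlgHom k ⟨freeToGraded r, h⟩)
    (by
      apply RingQuot.ringQuot_ext'
      apply FreeAlgebra.hom_ext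
      funext i
      simp [freeToGraded, generatorClass])
    (by
      have hone : ∀ a : RingQuot r, a ∈ Submodule.span k (Set.range (generatorClass r)) →
          ∀ ha : a ∈ wordGrading r 1,
          RingQuot.liftAlgHom k ⟨freeToGraded r, h⟩ a =
            DirectSum.of (fun n => wordGrading r n) 1 ⟨a, ha⟩ := by
        intro a ha
        induction ha using Submodule.span_induction with
        | mem a ha =>
          obtain ⟨i, rfl⟩ := ha
          intro _
          simp [freeToGraded, generatorClass]
        | zero =>
          intro _
          rw [map_zero]
          exact (map_zero _).symm
        | add a b ha hb iha ihb =>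
          intro _
          rw [← pow_one (Submodule.span k _)] at ha hb
          rw [map_add, iha ha, ihb hb, ← map_add]
          rfl
        | smul c a ha iha =>
          intro _
          rw [← pow_one (Submodule.span k _)] at ha
          rw [map_smul, iha ha]
          exact (DirectSum.lof k ℕ (fun n => wordGrading r n) 1).map_smul c ⟨a, ha⟩ |>.symm
      rintro n ⟨a, ha⟩
      change RingQuot.liftAlgHom k ⟨freeToGraded r, h⟩ a = _
      induction ha using Submodule.pow_induction_on_left' with
      | algebraMap c =>
        rw [AlgHom.commutes, DirectSum.algebraMap_apply]
        rfl
      | add a b n ha hb iha ihb =>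
        rw [map_add, iha, ihb, ← map_add]
        rfl
      | mem_mul m hm n a ha iha =>
        have hm' : m ∈ wordGrading r 1 := by rwa [wordGrading, pow_one]
        rw [map_mul, iha, hone m hm hm', DirectSum.of_mul_of]
        refine DirectSum.of_eq_of_gradedMonoid_eq (Sigma.subtype_ext ?_ rfl)
        exact add_comm 1 n)

/-! ### The two algebras -/

/-- The three generators. -/
inductive Gen
  | x
  | y
  | z

/-- The relations `xy = 0`, `yz = 0`, `xz = zx`. -/
inductive FirstRel (k : Type*) [Field k] : FreeAlgebra k Gen → FreeAlgebra k Gen → Prop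
  | xy : FirstRel k (FreeAlgebra.ι k Gen.x * FreeAlgebra.ι k Gen.y) 0
  | yz : FirstRel k (FreeAlgebra.ι k Gen.y * FreeAlgebra.ι k Gen.z) 0
  | xz : FirstRel k (FreeAlgebra.ι k Gen.x * FreeAlgebra.ι k Gen.z)
      (FreeAlgebra.ι k Gen.z * FreeAlgebra.ι k Gen.x)

/-- The relations `yz = 0`, `xz = zx`. -/
inductive SecondRel (k : Type*) [Field k] : FreeAlgebra k Gen → FreeAlgebra k Gen → Prop
  | yz : SecondRel k (FreeAlgebra.ι k Gen.y * FreeAlgebra.ι k Gen.z) 0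
  | xz : SecondRel k (FreeAlgebra.ι k Gen.x * FreeAlgebra.ι k Gen.z)
      (FreeAlgebra.ι k Gen.z * FreeAlgebra.ι k Gen.x)

theorem freeToGraded_mul_eq {k X : Type*} [Field k]
    (r : FreeAlgebra k X → FreeAlgebra k X → Prop) (i j i' j' : X)
    (h : r (FreeAlgebra.ι k i * FreeAlgebra.ι k j) (FreeAlgebra.ι k i' * FreeAlgebra.ι k j')) :
    freeToGraded r (FreeAlgebra.ι k i * FreeAlgebra.ι k j) =
      freeToGraded r (FreeAlgebra.ι k i' * FreeAlgebra.ι k j') := by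
  have e := RingQuot.mkAlgHom_rel k h
  rw [map_mul, map_mul] at e
  simp only [freeToGraded, map_mul, FreeAlgebra.lift_ι_apply, DirectSum.of_mul_of]
  exact DirectSum.of_eq_of_gradedMonoid_eq (Sigma.subtype_ext rfl e)

theorem freeToGraded_mul_eq_zero {k X : Type*} [Field k]
    (r : FreeAlgebra k X → FreeAlgebra k X → Prop) (i j : X)
    (h : r (FreeAlgebra.ι k i * FreeAlgebra.ι k j) 0) :
    freeToGraded r (FreeAlgebra.ι k i * FreeAlgebra.ι k j) = freeToGraded r 0 := by
  have e := RingQuot.mkAlgHom_rel k h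
  rw [map_mul, map_zero] at e
  rw [map_zero]
  simp only [freeToGraded, map_mul, FreeAlgebra.lift_ι_apply, DirectSum.of_mul_of]
  refine (congrArg (DirectSum.of (fun n => wordGrading r n) (1 + 1)) ?_).trans
    (map_zero (DirectSum.of (fun n => wordGrading r n) (1 + 1)))
  exact Subtype.ext e

noncomputable instance firstGradedAlgebra (k : Type*) [Field k] :
    GradedAlgebra (wordGrading (FirstRel k)) :=
  wordGradedAlgebra _ fun _ _ h => by
    cases h with
    | xy => exact freeToGraded_mul_eq_zero _ _ _ FirstRel.xy
    | yz => exact freeToGraded_mul_eq_zero _ _ _ FirstRel.yz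
    | xz => exact freeToGraded_mul_eq _ _ _ _ _ FirstRel.xz

noncomputable instance secondGradedAlgebra (k : Type*) [Field k] :
    GradedAlgebra (wordGrading (SecondRel k)) :=
  wordGradedAlgebra _ fun _ _ h => by
    cases h with
    | yz => exact freeToGraded_mul_eq_zero _ _ _ SecondRel.yz
    | xz => exact freeToGraded_mul_eq _ _ _ _ _ SecondRel.xz

/-! ### Homogeneous components in graded free modules -/

section IntGrading

variable {k R : Type*} [Field k] [Ring R] [Algebra k R]

/-! Incoherence. If `xz = zx` and `yz = 0`, the left annihilator of `z`, a kernel of a graded map `R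
→ R(1)`, contains every `y * x ^ n`. It is not finitely generated: in a suitable triangular
representation over `k[X]` its elements become strictly upper triangular, so left multiplication
only rescales the corner entry by constants, and finitely many generators bound the degree of that
entry, while `y * x ^ n` has corner `X ^ n`. This is `not_isGradedLeftCoherent_of_representations`.
It applies to both algebras on the left, and to the opposite of the first one with `x` and `z`
exchanged.

Coherence. In the opposite of the second algebra, `zy = 0` and `zx = xz`. Let `C` be the subalgebra
generated by `x` and `z`; it is commutative and Noetherian. Then `zR ⊆ C`, and `x * a + y * b ∈ C`
forces `a ∈ C` and `b = 0`. If a homogeneous `v = x • a + y • b + z • c` is in `ker f`, it follows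
that `f a ∈ C` and `f b = 0`. Correcting `a` by a lift `t` of `f a` from a fixed finitely generated
`C`-module puts `a - t` in the kernel. Hence `v` is generated by kernel elements of lower degree and
by `x • t + z • c`, which lies in a Noetherian `C`-module (`ker_fg_of_isGradedHom`). -/

theorem intGrading_mul_mem {𝒜 : ℕ → Submodule k R} [SetLike.GradedMonoid 𝒜] {i j : ℤ} {a b : R}
    (ha : a ∈ intGrading 𝒜 i) (hb : b ∈ intGrading 𝒜 j) : a * b ∈ intGrading 𝒜 (i + j) := by
  cases i with
  | negSucc i =>
    rw [(Submodule.mem_bot k).1 ha, zero_mul]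
    exact zero_mem _
  | ofNat i =>
    cases j with
    | negSucc j =>
      rw [(Submodule.mem_bot k).1 hb, mul_zero]
      exact zero_mem _
    | ofNat j => exact SetLike.GradedMul.mul_mem (A := 𝒜) ha hb

theorem eq_zero_of_mem_intGrading {𝒜 : ℕ → Submodule k R} {i : ℤ} (hi : i < 0) {a : R}
    (ha : a ∈ intGrading 𝒜 i) : a = 0 := by
  obtain ⟨n, rfl⟩ := Int.eq_negSucc_of_lt_zero hi
  exact (Submodule.mem_bot k).1 ha

variable (𝒜 : ℕ → Submodule k R) [GradedAlgebra 𝒜]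

/-- The projection to the component of integral degree `i`. -/
noncomputable def intProj : ℤ → R →ₗ[k] R
  | Int.ofNat n => GradedAlgebra.proj 𝒜 n
  | Int.negSucc _ => 0

theorem intProj_mem (i : ℤ) (a : R) : intProj 𝒜 i a ∈ intGrading 𝒜 i := by
  cases i with
  | ofNat n => exact SetLike.coe_mem _
  | negSucc n => exact zero_mem _

theorem intProj_of_mem {i : ℤ} {a : R} (ha : a ∈ intGrading 𝒜 i) : intProj 𝒜 i a = a := by
  cases i with
  | ofNat n => exact DirectSum.decompose_of_mem_same 𝒜 ha
  | negSucc n => exact ((Submodule.mem_bot k).1 ha).symm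

theorem intProj_of_mem_ne {i j : ℤ} (hij : i ≠ j) {a : R} (ha : a ∈ intGrading 𝒜 i) :
    intProj 𝒜 j a = 0 := by
  cases j with
  | negSucc n => rfl
  | ofNat n =>
    cases i with
    | ofNat m =>
      exact DirectSum.decompose_of_mem_ne 𝒜 ha fun h => hij (congrArg Int.ofNat h)
    | negSucc m => rw [(Submodule.mem_bot k).1 ha, map_zero]

theorem intProj_mul_of_mem {e : ℤ} {b : R} (hb : b ∈ intGrading 𝒜 e) (m : ℤ) (a : R) :
    intProj 𝒜 m (a * b) = intProj 𝒜 (m - e) a * b := by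
  induction a using DirectSum.Decomposition.inductionOn 𝒜 with
  | zero => simp
  | add a a' h h' => rw [add_mul, map_add, map_add, h, h', add_mul]
  | @homogeneous n a =>
    have ha : (a : R) ∈ intGrading 𝒜 n := a.2
    by_cases h : (n : ℤ) = m - e
    · rw [← h, intProj_of_mem 𝒜 ha]
      have hm : m = n + e := by omega
      exact hm ▸ intProj_of_mem 𝒜 (intGrading_mul_mem ha hb)
    · rw [intProj_of_mem_ne 𝒜 h ha, zero_mul,
        intProj_of_mem_ne 𝒜 (i := n + e) (by omega) (intGrading_mul_mem ha hb)]

/-- Allowing every larger index set lets the supports of several elements be merged. -/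
theorem exists_sum_intProj_eq (a : R) :
    ∃ S : Finset ℤ, ∀ S', S ⊆ S' → ∑ i ∈ S', intProj 𝒜 i a = a := by
  classical
  induction a using DirectSum.Decomposition.inductionOn 𝒜 with
  | zero => exact ⟨∅, by simp⟩
  | add a a' h h' =>
    obtain ⟨S, h⟩ := h
    obtain ⟨T, h'⟩ := h'
    refine ⟨S ∪ T, fun S' hS' => ?_⟩
    simp only [map_add, Finset.sum_add_distrib]
    rw [h _ (Finset.union_subset_left hS'), h' _ (Finset.union_subset_right hS')]
  | @homogeneous n a =>
    have ha : (a : R) ∈ intGrading 𝒜 n := a.2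
    refine ⟨{(n : ℤ)}, fun S' hS' => ?_⟩
    rw [Finset.sum_eq_single_of_mem (n : ℤ) (hS' (Finset.mem_singleton_self _)),
      intProj_of_mem 𝒜 ha]
    intro j _ hj
    exact intProj_of_mem_ne 𝒜 hj.symm ha

variable {n : ℕ} (d : Fin n → ℤ)

/-- The component of degree `i` of the graded free module `R(d 0) ⊕ ⋯ ⊕ R(d (n - 1))`. -/
def freeGrading (𝒜 : ℕ → Submodule k R) (i : ℤ) : Submodule k (Fin n → R) :=
  Submodule.pi Set.univ fun s => intGrading 𝒜 (i + d s)

/-- The projection of the graded free module to its component of degree `i`. -/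
noncomputable def freeProj (i : ℤ) (v : Fin n → R) : Fin n → R :=
  fun s => intProj 𝒜 (i + d s) (v s)

variable {d}

theorem mem_freeGrading {𝒜 : ℕ → Submodule k R} {i : ℤ} {v : Fin n → R} :
    v ∈ freeGrading d 𝒜 i ↔ ∀ s, v s ∈ intGrading 𝒜 (i + d s) := by
  simp [freeGrading]

variable (d) in
theorem freeProj_mem (i : ℤ) (v : Fin n → R) : freeProj 𝒜 d i v ∈ freeGrading d 𝒜 i :=
  mem_freeGrading.2 fun _ => intProj_mem _ _ _

variable (d) in
theorem exists_sum_freeProj_eq (v : Fin n → R) :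
    ∃ S : Finset ℤ, ∑ i ∈ S, freeProj 𝒜 d i v = v := by
  classical
  choose S hS using fun s => exists_sum_intProj_eq 𝒜 (v s)
  refine ⟨Finset.univ.biUnion fun s => (S s).image (· - d s), ?_⟩
  ext s
  simp only [Finset.sum_apply, freeProj]
  rw [← Finset.sum_image (g := fun i => i + d s) (f := fun i => intProj 𝒜 i (v s))
    (fun _ _ _ _ h => add_right_cancel h)]
  refine hS s _ fun i hi => Finset.mem_image.2 ⟨i - d s, ?_, by omega⟩
  exact Finset.mem_biUnion.2 ⟨s, Finset.mem_univ _, Finset.mem_image_of_mem _ hi⟩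

theorem smul_mem_freeGrading {𝒜 : ℕ → Submodule k R} [SetLike.GradedMonoid 𝒜] {i j : ℤ} {a : R}
    {v : Fin n → R} (ha : a ∈ intGrading 𝒜 i) (hv : v ∈ freeGrading d 𝒜 j) :
    a • v ∈ freeGrading d 𝒜 (i + j) := by
  rw [mem_freeGrading] at hv ⊢
  intro s
  rw [add_assoc]
  exact intGrading_mul_mem ha (hv s)

variable {j : ℤ} {f : (Fin n → R) →ₗ[R] R}

theorem IsGradedHom.apply_mem {𝒜 : ℕ → Submodule k R}
    (hf : IsGradedHom 𝒜 (shiftGrading (intGrading 𝒜) j) d f) {i : ℤ} {v : Fin n → R}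
    (hv : v ∈ freeGrading d 𝒜 i) : f v ∈ intGrading 𝒜 (i + j) :=
  hf i v fun s => mem_freeGrading.1 hv s

/-- Expand `v` into components: `f` sends the one of degree `l` into degree `l + j`, so just the
term `l = i` survives on the right. -/
theorem IsGradedHom.apply_freeProj (hf : IsGradedHom 𝒜 (shiftGrading (intGrading 𝒜) j) d f)
    (i : ℤ) (v : Fin n → R) : f (freeProj 𝒜 d i v) = intProj 𝒜 (i + j) (f v) := by
  obtain ⟨S, hS⟩ := exists_sum_freeProj_eq 𝒜 d v
  by_cases hi : i ∈ S
  · conv_rhs => rw [← hS, map_sum, map_sum]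
    rw [Finset.sum_eq_single_of_mem i hi,
      intProj_of_mem 𝒜 (hf.apply_mem (freeProj_mem 𝒜 d i v))]
    intro l _ hl
    exact intProj_of_mem_ne 𝒜 (by omega) (hf.apply_mem (freeProj_mem 𝒜 d l v))
  · have h0 : freeProj 𝒜 d i v = 0 := by
      ext s
      have hs : v s = ∑ l ∈ S, freeProj 𝒜 d l v s := by
        rw [← Finset.sum_apply, hS]
      rw [freeProj, hs, map_sum]
      refine Finset.sum_eq_zero fun l hl => intProj_of_mem_ne 𝒜 (i := l + d s) ?_
        (intProj_mem _ _ _)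
      rintro h
      exact hi (add_right_cancel h ▸ hl)
    rw [h0, map_zero]
    conv_rhs => rw [← hS, map_sum, map_sum]
    symm
    refine Finset.sum_eq_zero fun l hl => intProj_of_mem_ne 𝒜 (i := l + j) ?_
      (hf.apply_mem (freeProj_mem 𝒜 d l v))
    rintro h
    exact hi (add_right_cancel h ▸ hl)

/-- The kernel of a graded homomorphism is generated by its homogeneous elements. -/
theorem IsGradedHom.ker_le (hf : IsGradedHom 𝒜 (shiftGrading (intGrading 𝒜) j) d f)
    {N : Submodule R (Fin n → R)}
    (hN : ∀ i, ∀ v ∈ freeGrading d 𝒜 i, f v = 0 → v ∈ N) : LinearMap.ker f ≤ N := by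
  intro v hv
  obtain ⟨S, hS⟩ := exists_sum_freeProj_eq 𝒜 d v
  rw [← hS]
  refine sum_mem fun i _ => hN i _ (freeProj_mem 𝒜 d i v) ?_
  rw [hf.apply_freeProj, LinearMap.mem_ker.1 hv, map_zero]

end IntGrading

/-! ### Coherence from a commutative Noetherian subalgebra -/

section Coherence

variable {k R : Type*} [Field k] [Ring R] [Algebra k R]

-- Hilbert's basis theorem: commuting generators give a finitely generated commutative algebra over
-- a field.
open scoped IsMulCommutative in
theorem isNoetherianRing_adjoin_pair {x z : R} (hzx : z * x = x * z) :
    IsNoetherianRing (Algebra.adjoin k {x, z}) := by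
  have hcomm : ∀ a ∈ ({x, z} : Set R), ∀ b ∈ ({x, z} : Set R), a * b = b * a := by
    rintro a (rfl | rfl) b (rfl | rfl)
    exacts [rfl, hzx.symm, hzx, rfl]
  have := Algebra.isMulCommutative_adjoin k hcomm
  have hfg : (Algebra.adjoin k ({x, z} : Set R)).FG :=
    Subalgebra.fg_def.2 ⟨_, Set.toFinite _, rfl⟩
  have := (Subalgebra.fg_iff_finiteType _).1 hfg
  exact Algebra.FiniteType.isNoetherianRing k (Algebra.adjoin k ({x, z} : Set R))

section Lift

variable {𝒜 : ℕ → Submodule k R} [GradedAlgebra 𝒜]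

theorem intProj_mem_adjoin {s : Set R} (hs : ∀ a ∈ s, a ∈ 𝒜 1) {c : R}
    (hc : c ∈ Algebra.adjoin k s) (i : ℤ) : intProj 𝒜 i c ∈ Algebra.adjoin k s := by
  have hom : ∀ (n : ℕ), ∀ a ∈ 𝒜 n, a ∈ Algebra.adjoin k s → ∀ i : ℤ,
      intProj 𝒜 i a ∈ Algebra.adjoin k s := by
    intro n a ha has i
    have ha : a ∈ intGrading 𝒜 n := ha
    by_cases h : (n : ℤ) = i
    · rw [← h, intProj_of_mem 𝒜 ha]
      exact has
    · rw [intProj_of_mem_ne 𝒜 h ha]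
      exact zero_mem _
  induction hc using Algebra.adjoin_induction generalizing i with
  | algebraMap r => exact hom 0 _ (SetLike.algebraMap_mem_graded 𝒜 r) (algebraMap_mem _ r) i
  | mem a ha => exact hom 1 a (hs a ha) (Algebra.subset_adjoin ha) i
  | add a b ha hb iha ihb =>
    rw [map_add]
    exact add_mem (iha i) (ihb i)
  | mul a b ha hb iha ihb =>
    obtain ⟨S, hS⟩ := exists_sum_intProj_eq 𝒜 b
    rw [← hS S subset_rfl, Finset.mul_sum, map_sum]
    refine sum_mem fun e _ => ?_
    rw [intProj_mul_of_mem 𝒜 (intProj_mem 𝒜 e b)]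
    exact mul_mem (iha _) (ihb _)

/-- Elements of `f⁻¹(C)` can be corrected modulo `ker f` by elements of a finitely generated
`C`-submodule, without changing degrees. -/
theorem IsGradedHom.exists_fg_lift {C : Subalgebra k R} [IsNoetherianRing C]
    (hC : ∀ c ∈ C, ∀ i, intProj 𝒜 i c ∈ C) {n : ℕ} {d : Fin n → ℤ} {j : ℤ}
    {f : (Fin n → R) →ₗ[R] R} (hf : IsGradedHom 𝒜 (shiftGrading (intGrading 𝒜) j) d f) :
    ∃ T : Submodule C (Fin n → R), T.FG ∧ ∀ i, ∀ u ∈ freeGrading d 𝒜 i, f u ∈ C →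
      ∃ t ∈ T, t ∈ freeGrading d 𝒜 i ∧ f t = f u := by
  classical
  -- The values in `C` of `f` on homogeneous vectors. They span a submodule of the cyclic `C`-module
  -- `C • 1`, which is Noetherian, so finitely many of them suffice, each with a homogeneous
  -- preimage.
  let W : Set R := {w | w ∈ C ∧ ∃ i, ∃ u ∈ freeGrading d 𝒜 i, f u = w}
  have hW : (Submodule.span C W).FG := by
    have hle : Submodule.span C W ≤ LinearMap.range (LinearMap.toSpanSingleton C R 1) :=
      Submodule.span_le.2 fun w hw => ⟨⟨w, hw.1⟩, by simp [Subalgebra.smul_def]⟩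
    exact isNoetherian_submodule.1 (isNoetherian_of_surjective _
      (LinearMap.range_rangeRestrict (LinearMap.toSpanSingleton C R 1))) _ hle
  obtain ⟨S, hSW, hS⟩ := (Submodule.fg_span_iff_fg_span_finset_subset W).1 hW
  choose! e u hu hfu using fun w (hw : w ∈ W) => hw.2
  refine ⟨Submodule.span C (u '' S), Submodule.fg_span (S.finite_toSet.image _), ?_⟩
  -- The factor `c` absorbs scalars in the induction over the span; taking the component of degree
  -- `m + j` keeps the lift homogeneous.
  have key : ∀ w ∈ Submodule.span C (S : Set R), ∀ c ∈ C, ∀ m : ℤ,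
      ∃ t ∈ Submodule.span C (u '' S), t ∈ freeGrading d 𝒜 m ∧
        f t = intProj 𝒜 (m + j) (c * w) := by
    intro w hw
    induction hw using Submodule.span_induction with
    | zero => exact fun c _ m => ⟨0, zero_mem _, zero_mem _, by simp⟩
    | add w w' _ _ h h' =>
      intro c hc m
      obtain ⟨t, ht, htm, hft⟩ := h c hc m
      obtain ⟨t', ht', htm', hft'⟩ := h' c hc m
      exact ⟨t + t', add_mem ht ht', add_mem htm htm', by rw [map_add, hft, hft', mul_add, map_add]⟩
    | smul a w _ h =>
      intro c hc m
      obtain ⟨t, ht, htm, hft⟩ := h (c * a) (mul_mem hc a.2) m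
      exact ⟨t, ht, htm, by rw [hft, Subalgebra.smul_def, smul_eq_mul, mul_assoc]⟩
    | mem w hw =>
      intro c hc m
      have hwW := hSW hw
      refine ⟨intProj 𝒜 (m - e w) c • u w, ?_, ?_, ?_⟩
      · exact Submodule.smul_mem _ (⟨_, hC c hc _⟩ : C)
          (Submodule.subset_span (Set.mem_image_of_mem _ hw))
      · simpa using smul_mem_freeGrading (intProj_mem 𝒜 (m - e w) c) (hu w hwW)
      · have hdeg := hf.apply_mem (hu w hwW)
        rw [hfu w hwW] at hdeg
        rw [map_smul, hfu w hwW, intProj_mul_of_mem 𝒜 hdeg, smul_eq_mul]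
        congr 3
        omega
  intro i v hv hfv
  have hmem : f v ∈ Submodule.span C (S : Set R) :=
    hS ▸ Submodule.subset_span ⟨hfv, i, v, hv, rfl⟩
  obtain ⟨t, ht, hti, hft⟩ := key _ hmem 1 (one_mem _) i
  exact ⟨t, ht, hti, by rw [hft, one_mul, intProj_of_mem 𝒜 (hf.apply_mem hv)]⟩

end Lift

variable {𝒜 : ℕ → Submodule k R} {x y z : R}
  (h0 : ∀ a ∈ 𝒜 0, ∃ c : k, algebraMap k R c = a)
  (hgen : ∀ n, ∀ a ∈ 𝒜 (n + 1), ∃ b ∈ 𝒜 n, ∃ c ∈ 𝒜 n, ∃ e ∈ 𝒜 n, a = x * b + y * c + z * e)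

include h0 hgen

theorem graded_piece_fg (n : ℕ) : (𝒜 n).FG := by
  induction n with
  | zero =>
    refine Submodule.FG.of_le_of_isNoetherian (T := LinearMap.range (Algebra.linearMap k R)) ?_
    intro a ha
    exact h0 a ha
  | succ n ih =>
    have hfg := ((ih.map (LinearMap.mulLeft k x)).sup (ih.map (LinearMap.mulLeft k y))).sup
      (ih.map (LinearMap.mulLeft k z))
    have := Module.Finite.iff_fg.2 hfg
    refine Submodule.FG.of_le_of_isNoetherian (T := (𝒜 n).map (LinearMap.mulLeft k x) ⊔
      (𝒜 n).map (LinearMap.mulLeft k y) ⊔ (𝒜 n).map (LinearMap.mulLeft k z)) fun a ha => ?_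
    obtain ⟨b, hb, c, hc, e, he, rfl⟩ := hgen n a ha
    exact add_mem (Submodule.mem_sup_left (add_mem (Submodule.mem_sup_left ⟨b, hb, rfl⟩)
      (Submodule.mem_sup_right ⟨c, hc, rfl⟩))) (Submodule.mem_sup_right ⟨e, he, rfl⟩)

theorem freeGrading_fg {n : ℕ} (d : Fin n → ℤ) (i : ℤ) : (freeGrading d 𝒜 i).FG := by
  refine Submodule.fg_pi fun s => ?_
  cases h : i + d s with
  | ofNat m => exact graded_piece_fg h0 hgen m
  | negSucc m => exact Submodule.fg_bot

theorem positivePart_fg (hx : x ∈ 𝒜 1) (hy : y ∈ 𝒜 1) (hz : z ∈ 𝒜 1) :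
    (positivePart 𝒜).FG := by
  suffices h : positivePart 𝒜 = Submodule.span R {x, y, z} from
    h ▸ Submodule.fg_span (Set.toFinite _)
  refine le_antisymm (Submodule.span_le.2 ?_) (Submodule.span_mono ?_)
  · rintro a ⟨n, hn, ha⟩
    obtain ⟨n, rfl⟩ := Nat.exists_eq_succ_of_ne_zero hn.ne'
    clear hn
    have hmem : ∀ g ∈ ({x, y, z} : Set R), g ∈ Submodule.span R {x, y, z} := fun g hg =>
      Submodule.subset_span hg
    have hscalar : ∀ g ∈ ({x, y, z} : Set R), ∀ b ∈ 𝒜 0, g * b ∈ Submodule.span R {x, y, z} := by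
      intro g hg b hb
      obtain ⟨c, rfl⟩ := h0 b hb
      rw [← Algebra.commutes c g]
      exact Submodule.smul_mem _ _ (hmem g hg)
    induction n generalizing a with
    | zero =>
      obtain ⟨b, hb, c, hc, e, he, rfl⟩ := hgen 0 a ha
      exact add_mem (add_mem (hscalar x (by simp) b hb) (hscalar y (by simp) c hc))
        (hscalar z (by simp) e he)
    | succ n ih =>
      obtain ⟨b, hb, c, hc, e, he, rfl⟩ := hgen _ a ha
      exact add_mem (add_mem (Submodule.smul_mem _ x (ih hb)) (Submodule.smul_mem _ y (ih hc)))
        (Submodule.smul_mem _ z (ih he))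
  · rintro a (rfl | rfl | rfl)
    exacts [⟨1, one_pos, hx⟩, ⟨1, one_pos, hy⟩, ⟨1, one_pos, hz⟩]

variable [GradedAlgebra 𝒜]

theorem left_mul_generators_induction {p : R → Prop} (scalar : ∀ c, p (algebraMap k R c))
    (add : ∀ a b, p a → p b → p (a + b)) (hx : ∀ a, p a → p (x * a)) (hy : ∀ a, p a → p (y * a))
    (hz : ∀ a, p a → p (z * a)) (a : R) : p a := by
  induction a using DirectSum.Decomposition.inductionOn 𝒜 with
  | zero => simpa using scalar 0
  | add a b ha hb => exact add a b ha hb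
  | @homogeneous n a =>
    obtain ⟨a, ha⟩ := a
    change p a
    induction n generalizing a with
    | zero =>
      obtain ⟨c, rfl⟩ := h0 a ha
      exact scalar c
    | succ n ih =>
      obtain ⟨b, hb, c, hc, e, he, rfl⟩ := hgen n a ha
      exact add _ _ (add _ _ (hx _ (ih b hb)) (hy _ (ih c hc))) (hz _ (ih e he))

/-- Descent on degree: modulo kernel elements of lower degree, a homogeneous kernel element can be
moved into a fixed finitely generated `C`-module, except in finitely many degrees, whose components
are finite-dimensional. -/
theorem ker_fg_of_isGradedHom {C : Subalgebra k R} [IsNoetherianRing C]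
    (hC : ∀ c ∈ C, ∀ i, intProj 𝒜 i c ∈ C) (hxC : x ∈ C) (hz : ∀ a, z * a ∈ C)
    (hxy : ∀ a b, x * a + y * b ∈ C → a ∈ C ∧ b = 0)
    {n : ℕ} {d : Fin n → ℤ} {j : ℤ} {f : (Fin n → R) →ₗ[R] R}
    (hf : IsGradedHom 𝒜 (shiftGrading (intGrading 𝒜) j) d f) : (LinearMap.ker f).FG := by
  classical
  obtain ⟨T, hT, hlift⟩ := hf.exists_fg_lift hC
  -- The second summand is `C ^ n`; it is there to contain `z • c`.
  let T' : Submodule C (Fin n → R) :=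
    T ⊔ Submodule.span C (Set.range fun s => Pi.single s (1 : R))
  have hT' : T'.FG := hT.sup (Submodule.fg_span (Set.finite_range _))
  have : IsNoetherian C T' := isNoetherian_of_fg_of_noetherian _ hT'
  have hCT' : ∀ v : Fin n → R, (∀ s, v s ∈ C) → v ∈ T' := by
    intro v hv
    refine Submodule.mem_sup_right ?_
    have : v = ∑ s, (⟨v s, hv s⟩ : C) • (Pi.single s (1 : R) : Fin n → R) := by
      ext s
      simp [Finset.sum_apply, Pi.single_apply, Subalgebra.smul_def]
    rw [this]
    exact sum_mem fun s _ => Submodule.smul_mem _ _ (Submodule.subset_span ⟨s, rfl⟩)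
  let K₁ : Submodule C (Fin n → R) := (LinearMap.ker f).restrictScalars C ⊓ T'
  -- In degree `-d s` the coordinate `s` is a scalar, from which no generator can be factored out;
  -- these degrees are handled by finite dimensionality.
  let K₂ : Fin n → Submodule k (Fin n → R) := fun s =>
    (LinearMap.ker f).restrictScalars k ⊓ freeGrading d 𝒜 (-d s)
  have hK₁ : K₁.FG := Submodule.FG.of_le_of_isNoetherian (T := T') inf_le_right
  have hK₂ : ∀ s, (K₂ s).FG := fun s => by
    have := Module.Finite.iff_fg.2 (freeGrading_fg h0 hgen d (-d s))
    exact Submodule.FG.of_le_of_isNoetherian (T := freeGrading d 𝒜 (-d s)) inf_le_right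
  let N : Submodule R (Fin n → R) := Submodule.span R (K₁ : Set (Fin n → R)) ⊔
    ⨆ s, Submodule.span R (K₂ s : Set (Fin n → R))
  have hN : N.FG := hK₁.span.sup (Submodule.fg_iSup _ fun s => (hK₂ s).span)
  have hNle : N ≤ LinearMap.ker f :=
    sup_le (Submodule.span_le.2 fun v hv => hv.1)
      (iSup_le fun s => Submodule.span_le.2 fun v hv => hv.1)
  have hK₁N : ∀ v ∈ T', f v = 0 → v ∈ N := fun v hv hfv =>
    Submodule.mem_sup_left (Submodule.subset_span ⟨hfv, hv⟩)
  have key : ∀ (m : ℕ) (i : ℤ), (∀ s, i + d s < m) → ∀ v ∈ freeGrading d 𝒜 i, f v = 0 →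
      v ∈ N := by
    intro m
    induction m with
    | zero =>
      intro i hi v hv _
      have : v = 0 := by
        ext s
        exact eq_zero_of_mem_intGrading (hi s) (mem_freeGrading.1 hv s)
      rw [this]
      exact zero_mem _
    | succ m ih =>
      intro i hi v hv hfv
      by_cases hs : ∃ s, i = -d s
      · obtain ⟨s, rfl⟩ := hs
        exact Submodule.mem_sup_right
          (Submodule.mem_iSup_of_mem s (Submodule.subset_span ⟨hfv, hv⟩))
      -- No coordinate has degree zero here. The homogeneity of `e` is not recorded: only `z * e ∈
      -- C` matters.
      have hsplit : ∀ s, ∃ b ∈ intGrading 𝒜 (i - 1 + d s), ∃ c ∈ intGrading 𝒜 (i - 1 + d s),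
          ∃ e : R, v s = x * b + y * c + z * e := by
        intro s
        have hvs := mem_freeGrading.1 hv s
        rcases lt_trichotomy (i + d s) 0 with h | h | h
        · rw [eq_zero_of_mem_intGrading h hvs]
          exact ⟨0, zero_mem _, 0, zero_mem _, 0, by simp⟩
        · exact absurd ⟨s, by omega⟩ hs
        · obtain ⟨l, hl⟩ := Int.eq_ofNat_of_zero_le (show 0 ≤ i - 1 + d s by omega)
          rw [show i + d s = ((l + 1 : ℕ) : ℤ) by push_cast; omega] at hvs
          obtain ⟨b, hb, c, hc, e, -, h⟩ := hgen l (v s) hvs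
          rw [hl]
          exact ⟨b, hb, c, hc, e, h⟩
      choose a ha b hb c hv' using hsplit
      have hv' : v = x • a + y • b + z • c := funext hv'
      have hzc : ∀ s, (z • c) s ∈ C := fun s => hz (c s)
      have hrel : x * f a + y * f b ∈ C := by
        have : x * f a + y * f b = -(z * f c) := by
          rw [hv'] at hfv
          simp only [map_add, map_smul, smul_eq_mul] at hfv
          exact eq_neg_of_add_eq_zero_left hfv
        rw [this]
        exact neg_mem (hz _)
      obtain ⟨hfa, hfb⟩ := hxy _ _ hrel
      obtain ⟨t, ht, hti, hft⟩ := hlift (i - 1) a (mem_freeGrading.2 ha) hfa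
      have hi' : ∀ s, i - 1 + d s < m := fun s => by
        have := hi s
        push_cast at this
        omega
      have hbN := ih (i - 1) hi' b (mem_freeGrading.2 hb) hfb
      have hatN := ih (i - 1) hi' (a - t) (sub_mem (mem_freeGrading.2 ha) hti)
        (by rw [map_sub, hft, sub_self])
      -- This is what remains of `v` once `x • (a - t)` and `y • b` are removed, so it is again in
      -- the kernel; it lies in `T'`.
      have hrest : x • t + z • c ∈ N := by
        refine hK₁N _ (add_mem ?_ (hCT' _ hzc)) ?_
        · exact Submodule.mem_sup_left (Submodule.smul_mem _ (⟨x, hxC⟩ : C) ht)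
        · rw [hv'] at hfv
          simp only [map_add, map_smul, hfb, smul_zero, add_zero, hft] at hfv ⊢
          exact hfv
      have : v = x • (a - t) + y • b + (x • t + z • c) := by
        rw [hv', smul_sub]
        abel
      rw [this]
      exact add_mem (add_mem (Submodule.smul_mem _ _ hatN) (Submodule.smul_mem _ _ hbN)) hrest
  refine le_antisymm (hf.ker_le 𝒜 fun i v hv hfv => ?_) hNle ▸ hN
  obtain ⟨m, hm⟩ : ∃ m : ℕ, ∀ s, i + d s < m := by
    refine ⟨∑ s, (i + d s).toNat + 1, fun s => ?_⟩
    have := Finset.single_le_sum (f := fun s => (i + d s).toNat) (fun _ _ => Nat.zero_le _)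
      (Finset.mem_univ s)
    omega
  exact key m i hm v hv hfv

theorem exists_sub_algebraMap_mem_positivePart (hx : x ∈ 𝒜 1) (hy : y ∈ 𝒜 1) (hz : z ∈ 𝒜 1)
    (a : R) : ∃ c : k, a - algebraMap k R c ∈ positivePart 𝒜 := by
  have hmul : ∀ g ∈ 𝒜 1, ∀ a : R, (∃ c : k, a - algebraMap k R c ∈ positivePart 𝒜) →
      ∃ c : k, g * a - algebraMap k R c ∈ positivePart 𝒜 := by
    rintro g hg a ⟨c, hc⟩
    -- The constant is `0` because `R_+` is stable under right multiplication by scalars: `g * a = g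
    -- * (a - c) + c * g`.
    refine ⟨0, ?_⟩
    have hgP : g ∈ positivePart 𝒜 := Submodule.subset_span ⟨1, one_pos, hg⟩
    have : g * a - algebraMap k R 0 = g • (a - algebraMap k R c) + algebraMap k R c • g := by
      rw [map_zero, sub_zero, smul_eq_mul, smul_eq_mul, mul_sub, Algebra.commutes c g,
        sub_add_cancel]
    rw [this]
    exact add_mem (Submodule.smul_mem _ _ hc) (Submodule.smul_mem _ _ hgP)
  induction a using left_mul_generators_induction h0 hgen with
  | scalar c => exact ⟨c, by simp⟩
  | add a b ha hb =>
    obtain ⟨c, hc⟩ := ha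
    obtain ⟨e, he⟩ := hb
    refine ⟨c + e, ?_⟩
    rw [map_add, add_sub_add_comm]
    exact add_mem hc he
  | hx a ha => exact hmul x hx a ha
  | hy a ha => exact hmul y hy a ha
  | hz a ha => exact hmul z hz a ha

/-- `R_+` annihilates `R / R_+`, so the kernel contains `(R_+) ^ n`, which is finitely generated;
the quotient by it is finite-dimensional. -/
theorem ker_fg_of_quotient_positivePart (hx : x ∈ 𝒜 1) (hy : y ∈ 𝒜 1) (hz : z ∈ 𝒜 1) {n : ℕ}
    (f : (Fin n → R) →ₗ[R] R ⧸ positivePart 𝒜) : (LinearMap.ker f).FG := by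
  classical
  have hsurj := exists_sub_algebraMap_mem_positivePart h0 hgen hx hy hz
  have hkill : ∀ a ∈ positivePart 𝒜, ∀ q : R ⧸ positivePart 𝒜, a • q = 0 := by
    intro a ha q
    obtain ⟨b, rfl⟩ := Submodule.mkQ_surjective _ q
    obtain ⟨c, hc⟩ := hsurj b
    rw [← map_smul, Submodule.mkQ_apply, Submodule.Quotient.mk_eq_zero]
    have : a • b = a • (b - algebraMap k R c) + algebraMap k R c • a := by
      rw [smul_eq_mul, smul_eq_mul, smul_eq_mul, mul_sub, Algebra.commutes c a, sub_add_cancel]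
    rw [this]
    exact add_mem (Submodule.smul_mem _ _ hc) (Submodule.smul_mem _ _ ha)
  have hfin : Module.Finite k (R ⧸ positivePart 𝒜) := by
    refine Module.Finite.of_surjective
      (((positivePart 𝒜).mkQ.restrictScalars k) ∘ₗ Algebra.linearMap k R) fun q => ?_
    obtain ⟨b, rfl⟩ := Submodule.mkQ_surjective _ q
    obtain ⟨c, hc⟩ := hsurj b
    exact ⟨c, ((Submodule.Quotient.eq _).2 hc).symm⟩
  have : IsNoetherian R (R ⧸ positivePart 𝒜) := isNoetherian_of_tower k inferInstance
  let g : (Fin n → R) →ₗ[R] (Fin n → R ⧸ positivePart 𝒜) :=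
    LinearMap.pi fun s => (positivePart 𝒜).mkQ ∘ₗ LinearMap.proj s
  have hg : LinearMap.ker g = Submodule.pi Set.univ fun _ => positivePart 𝒜 := by
    ext v
    simp [g, funext_iff]
  have hgf : LinearMap.ker g ≤ LinearMap.ker f := by
    intro v hv
    rw [hg, Submodule.mem_pi] at hv
    rw [LinearMap.mem_ker, pi_eq_sum_univ' v, map_sum]
    refine Finset.sum_eq_zero fun s _ => ?_
    rw [map_smul]
    exact hkill _ (hv s trivial) _
  refine Submodule.fg_of_fg_map_of_fg_inf_ker g (IsNoetherian.noetherian _) ?_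
  rw [inf_eq_right.2 hgf, hg]
  exact Submodule.fg_pi fun _ => positivePart_fg h0 hgen hx hy hz

/-- If `zy = 0` and `zx = xz` are all the relations, in the sense that `R` acts on `R³` by the
given matrices, then `R` is left coherent. -/
theorem isGradedLeftCoherent_of_matrix_action (hx : x ∈ 𝒜 1) (hy : y ∈ 𝒜 1) (hz : z ∈ 𝒜 1)
    (hzx : z * x = x * z) (hzy : z * y = 0) (D : R →ₐ[k] Matrix (Fin 3) (Fin 3) R)
    (hDx : D x = !![x, 0, 0; 1, 0, 0; 0, 0, 0]) (hDy : D y = !![y, 0, 0; 0, 0, 0; 1, 0, 0])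
    (hDz : D z = !![z, 0, 0; 0, z, 0; 0, 0, 0]) : IsGradedLeftCoherent 𝒜 := by
  -- The first column of `D a` consists of `a` and its left quotients by `x` and by `y`: for `x * a`
  -- it is `(x * a, a, 0)`, for `y * a` it is `(y * a, 0, a)`.
  have hD : ∀ a, D a 0 0 = a := fun a => by
    induction a using left_mul_generators_induction h0 hgen with
    | scalar c => simp [AlgHom.commutes, Matrix.algebraMap_matrix_apply]
    | add a b ha hb => rw [map_add, Matrix.add_apply, ha, hb]
    | hx a ha => simp [hDx, Matrix.mul_apply, Fin.sum_univ_three, ha]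
    | hy a ha => simp [hDy, Matrix.mul_apply, Fin.sum_univ_three, ha]
    | hz a ha => simp [hDz, Matrix.mul_apply, Fin.sum_univ_three, ha]
  have hxC : x ∈ Algebra.adjoin k {x, z} := Algebra.subset_adjoin (by simp)
  have hzC : z ∈ Algebra.adjoin k {x, z} := Algebra.subset_adjoin (by simp)
  -- On `C` the quotient by `x` stays in `C` and the quotient by `y` vanishes. The entry `2 1` is
  -- carried along to make the claim multiplicative.
  have hDC : ∀ c ∈ Algebra.adjoin k {x, z},
      (∀ i j, D c i j ∈ Algebra.adjoin k {x, z}) ∧ D c 2 0 = 0 ∧ D c 2 1 = 0 := by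
    intro c hc
    induction hc using Algebra.adjoin_induction with
    | mem a ha =>
      rcases ha with rfl | rfl
      · rw [hDx]
        refine ⟨fun i j => ?_, rfl, rfl⟩
        fin_cases i <;> fin_cases j <;> simp [hxC, one_mem, zero_mem]
      · rw [hDz]
        refine ⟨fun i j => ?_, rfl, rfl⟩
        fin_cases i <;> fin_cases j <;> simp [hzC, zero_mem]
    | algebraMap r =>
      refine ⟨fun i j => ?_, ?_, ?_⟩
      · rw [AlgHom.commutes, Matrix.algebraMap_matrix_apply]
        split_ifs
        exacts [algebraMap_mem _ r, zero_mem _]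
      · simp [AlgHom.commutes, Matrix.algebraMap_matrix_apply]
      · simp [AlgHom.commutes, Matrix.algebraMap_matrix_apply]
    | add a b _ _ ha hb =>
      rw [map_add]
      exact ⟨fun i j => add_mem (ha.1 i j) (hb.1 i j), by simp [ha.2, hb.2], by simp [ha.2, hb.2]⟩
    | mul a b _ _ ha hb =>
      rw [map_mul]
      refine ⟨fun i j => ?_, ?_, ?_⟩
      · rw [Matrix.mul_apply]
        exact sum_mem fun l _ => mul_mem (ha.1 i l) (hb.1 l j)
      · simp [Matrix.mul_apply, Fin.sum_univ_three, ha.2, hb.2]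
      · simp [Matrix.mul_apply, Fin.sum_univ_three, ha.2, hb.2]
  -- `z` moves past each leading `x` or `z` and is killed by the first `y`.
  have hzmul : ∀ a, z * a ∈ Algebra.adjoin k {x, z} := fun a => by
    induction a using left_mul_generators_induction h0 hgen with
    | scalar c => exact mul_mem hzC (algebraMap_mem _ c)
    | add a b ha hb => exact mul_add z a b ▸ add_mem ha hb
    | hx a ha =>
      rw [← mul_assoc, hzx, mul_assoc]
      exact mul_mem hxC ha
    | hy a ha =>
      rw [← mul_assoc, hzy, zero_mul]
      exact zero_mem _
    | hz a ha => exact mul_mem hzC ha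
  have hxy : ∀ a b, x * a + y * b ∈ Algebra.adjoin k {x, z} →
      a ∈ Algebra.adjoin k {x, z} ∧ b = 0 := by
    intro a b h
    obtain ⟨h1, h2, -⟩ := hDC _ h
    have h1 := h1 1 0
    -- Rows 1 and 2 of the first column of `D (x * a + y * b)` are `a` and `b`.
    simp only [map_add, map_mul, hDx, hDy, Matrix.add_apply, Matrix.mul_apply,
      Fin.sum_univ_three] at h1 h2
    simp [hD] at h1 h2
    exact ⟨h1, h2⟩
  have := isNoetherianRing_adjoin_pair (k := k) hzx
  have hs : ∀ a ∈ ({x, z} : Set R), a ∈ 𝒜 1 := by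
    rintro a (rfl | rfl)
    exacts [hx, hz]
  exact ⟨fun j => ⟨inferInstance, fun n d f hf => ker_fg_of_isGradedHom h0 hgen
      (fun c hc i => intProj_mem_adjoin hs hc i) hxC hzmul hxy hf⟩,
    fun j => ⟨inferInstance, fun n d f _ => ker_fg_of_quotient_positivePart h0 hgen hx hy hz f⟩⟩

end Coherence

/-! ### An annihilator that is not finitely generated -/

section Incoherence

open Polynomial

variable {k R : Type*} [Field k] [Ring R] [Algebra k R]
  {𝒜 : ℕ → Submodule k R} [GradedAlgebra 𝒜] {x y z : R}

/-- If `xz = zx` and `yz = 0`, and `R` has the two given representations, then the left annihilator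
of `z` is not finitely generated. -/
theorem not_isGradedLeftCoherent_of_representations
    (h0 : ∀ a ∈ 𝒜 0, ∃ c : k, algebraMap k R c = a)
    (hgen : ∀ n, ∀ a ∈ 𝒜 (n + 1), ∃ b ∈ 𝒜 n, ∃ c ∈ 𝒜 n, ∃ e ∈ 𝒜 n, a = x * b + y * c + z * e)
    (hz : z ∈ 𝒜 1) (hxz : x * z = z * x) (hyz : y * z = 0)
    (ρ : R →ₐ[k] Matrix (Fin 2) (Fin 2) k[X]) (hρx : ρ x = !![0, 0; 0, X])
    (hρy : ρ y = !![0, 1; 0, 0]) (hρz : ρ z = 0)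
    (φ : R →ₐ[k] k[X][X]) (hφx : φ x = C X) (hφy : φ y = 0) (hφz : φ z = X) :
    ¬ IsGradedLeftCoherent 𝒜 := by
  -- `ρ` is upper triangular, and its diagonal is read off from `φ` by setting `z = 0`, and also `x
  -- = 0` in the upper entry.
  have hρ : ∀ a, ρ a 1 0 = 0 ∧ ρ a 0 0 = C (((φ a).coeff 0).coeff 0) ∧
      ρ a 1 1 = (φ a).coeff 0 := fun a => by
    induction a using left_mul_generators_induction h0 hgen with
    | scalar c =>
      simp [AlgHom.commutes, Matrix.algebraMap_matrix_apply, Polynomial.algebraMap_apply]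
    | add a b ha hb => simp [ha, hb]
    | hx a ha => simp [hρx, hφx, Matrix.mul_apply, ha]
    | hy a ha => simp [hρy, hφy, Matrix.mul_apply, ha]
    | hz a ha => simp [hρz, hφz]
  intro hcoh
  let f : (Fin 1 → R) →ₗ[R] R := LinearMap.toSpanSingleton R R z ∘ₗ LinearMap.proj 0
  have hf : ∀ v, f v = v 0 * z := fun v => rfl
  have hgr : IsGradedHom 𝒜 (shiftGrading (intGrading 𝒜) 1) (fun _ => 0) f := by
    intro i v hv
    have := hv 0
    rw [shiftGrading, add_zero] at this
    exact intGrading_mul_mem this (show z ∈ intGrading 𝒜 1 from hz)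
  obtain ⟨S, hS⟩ := (hcoh.1 1).2 1 _ f hgr
  -- `φ z` is a nonzero element of a domain, so `φ` kills the annihilator of `z`; by `hρ` the
  -- diagonal of `ρ` vanishes there.
  have hker : ∀ v ∈ Submodule.span R (S : Set (Fin 1 → R)), φ (v 0) = 0 := by
    intro v hv
    rw [hS, LinearMap.mem_ker, hf] at hv
    have := congrArg φ hv
    rw [map_mul, map_zero, hφz] at this
    exact (mul_eq_zero.1 this).resolve_right X_ne_zero
  let N := S.sup fun v => (ρ (v 0) 0 1).natDegree
  have hdeg : ∀ v ∈ Submodule.span R (S : Set (Fin 1 → R)), (ρ (v 0) 0 1).natDegree ≤ N := by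
    intro v hv
    induction hv using Submodule.span_induction with
    | mem v hv => exact Finset.le_sup (f := fun v : Fin 1 → R => (ρ (v 0) 0 1).natDegree) hv
    | zero => simp
    | add v w _ _ hv hw =>
      rw [Pi.add_apply, map_add, Matrix.add_apply]
      exact natDegree_add_le_of_degree_le hv hw
    | smul a v hv ih =>
      -- The lower diagonal entry of `ρ (v 0)` is zero, so `a` acts on the corner through the
      -- constant `ρ a 0 0`, and the degree cannot grow.
      have : ρ ((a • v) 0) 0 1 = C (((φ a).coeff 0).coeff 0) * ρ (v 0) 0 1 := by
        rw [Pi.smul_apply, smul_eq_mul, map_mul, Matrix.mul_apply, Fin.sum_univ_two, (hρ a).2.1,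
          (hρ (v 0)).2.2, hker v hv, coeff_zero, mul_zero, add_zero]
      rw [this]
      exact (natDegree_C_mul_le _ _).trans ih
  have hpow : ∀ n, ρ (y * x ^ n) 0 1 = X ^ n := by
    intro n
    induction n with
    | zero => simp [hρy]
    | succ n ih =>
      rw [pow_succ, ← mul_assoc, map_mul, Matrix.mul_apply, Fin.sum_univ_two, ih, hρx]
      simp [pow_succ]
  have hmem : (fun _ => y * x ^ (N + 1)) ∈ Submodule.span R (S : Set (Fin 1 → R)) := by
    rw [hS, LinearMap.mem_ker, hf, mul_assoc, (Commute.pow_left (show Commute x z from hxz) _).eq,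
      ← mul_assoc, hyz, zero_mul]
  have := hdeg _ hmem
  rw [hpow, natDegree_X_pow] at this
  omega

end Incoherence

/-! ### Generators, relations and opposite algebras -/

section Presentations

variable {k : Type*} [Field k]

theorem range_generatorClass (r : FreeAlgebra k Gen → FreeAlgebra k Gen → Prop) :
    Set.range (generatorClass r) =
      {generatorClass r Gen.x, generatorClass r Gen.y, generatorClass r Gen.z} := by
  ext a
  constructor
  · rintro ⟨_ | _ | _, rfl⟩ <;> simp
  · rintro (rfl | rfl | rfl) <;> exact ⟨_, rfl⟩

variable (r : FreeAlgebra k Gen → FreeAlgebra k Gen → Prop)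

theorem exists_algebraMap_eq_of_mem_wordGrading_zero {X : Type*}
    (r : FreeAlgebra k X → FreeAlgebra k X → Prop) (a : RingQuot r)
    (ha : a ∈ wordGrading r 0) : ∃ c : k, algebraMap k (RingQuot r) c = a := by
  rw [wordGrading, pow_zero] at ha
  exact Submodule.mem_one.1 ha

theorem exists_left_mul_generators (n : ℕ) (a : RingQuot r) (ha : a ∈ wordGrading r (n + 1)) :
    ∃ b ∈ wordGrading r n, ∃ c ∈ wordGrading r n, ∃ e ∈ wordGrading r n,
      a = generatorClass r Gen.x * b + generatorClass r Gen.y * c + generatorClass r Gen.z * e := by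
  rw [wordGrading, pow_succ', range_generatorClass] at ha
  induction ha using Submodule.mul_induction_on' with
  | mem_mul_mem m hm b hb =>
    obtain ⟨α, β, γ, rfl⟩ := Submodule.mem_span_triple.1 hm
    rw [← range_generatorClass] at hb
    exact ⟨α • b, Submodule.smul_mem _ _ hb, β • b, Submodule.smul_mem _ _ hb, γ • b,
      Submodule.smul_mem _ _ hb, by simp [add_mul]⟩
  | add a _ a' _ h h' =>
    obtain ⟨b, hb, c, hc, e, he, rfl⟩ := h
    obtain ⟨b', hb', c', hc', e', he', rfl⟩ := h'
    refine ⟨_, add_mem hb hb', _, add_mem hc hc', _, add_mem he he', ?_⟩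
    simp only [mul_add]
    abel

theorem exists_right_mul_generators (n : ℕ) (a : RingQuot r) (ha : a ∈ wordGrading r (n + 1)) :
    ∃ b ∈ wordGrading r n, ∃ c ∈ wordGrading r n, ∃ e ∈ wordGrading r n,
      a = b * generatorClass r Gen.x + c * generatorClass r Gen.y + e * generatorClass r Gen.z := by
  rw [wordGrading, pow_succ, range_generatorClass] at ha
  induction ha using Submodule.mul_induction_on' with
  | mem_mul_mem b hb m hm =>
    obtain ⟨α, β, γ, rfl⟩ := Submodule.mem_span_triple.1 hm
    rw [← range_generatorClass] at hb
    exact ⟨α • b, Submodule.smul_mem _ _ hb, β • b, Submodule.smul_mem _ _ hb, γ • b,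
      Submodule.smul_mem _ _ hb, by simp [mul_add]⟩
  | add a _ a' _ h h' =>
    obtain ⟨b, hb, c, hc, e, he, rfl⟩ := h
    obtain ⟨b', hb', c', hc', e', he', rfl⟩ := h'
    refine ⟨_, add_mem hb hb', _, add_mem hc hc', _, add_mem he he', ?_⟩
    simp only [add_mul]
    abel

open MulOpposite

theorem exists_algebraMap_eq_of_mem_opGrading_zero (a : (RingQuot r)ᵐᵒᵖ)
    (ha : a ∈ opGrading (wordGrading r) 0) : ∃ c : k, algebraMap k (RingQuot r)ᵐᵒᵖ c = a := by
  obtain ⟨c, hc⟩ := exists_algebraMap_eq_of_mem_wordGrading_zero r _ ha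
  exact ⟨c, congrArg op hc⟩

theorem exists_op_left_mul_generators (n : ℕ) (a : (RingQuot r)ᵐᵒᵖ)
    (ha : a ∈ opGrading (wordGrading r) (n + 1)) :
    ∃ b ∈ opGrading (wordGrading r) n, ∃ c ∈ opGrading (wordGrading r) n,
      ∃ e ∈ opGrading (wordGrading r) n, a = op (generatorClass r Gen.x) * b +
        op (generatorClass r Gen.y) * c + op (generatorClass r Gen.z) * e := by
  obtain ⟨b, hb, c, hc, e, he, h⟩ := exists_right_mul_generators r n _ ha
  exact ⟨op b, hb, op c, hc, op e, he, congrArg op h⟩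

/-- The assignment of values to the three generators. -/
def Gen.values {D : Type*} (X Y Z : D) : Gen → D
  | .x => X
  | .y => Y
  | .z => Z

variable {r} {D : Type*} [Ring D] [Algebra k D] {X Y Z : D}

theorem exists_presentationLift
    (h : ∀ ⦃a b⦄, r a b →
      FreeAlgebra.lift k (Gen.values X Y Z) a = FreeAlgebra.lift k (Gen.values X Y Z) b) :
    ∃ φ : RingQuot r →ₐ[k] D, φ (generatorClass r Gen.x) = X ∧
      φ (generatorClass r Gen.y) = Y ∧ φ (generatorClass r Gen.z) = Z := by
  refine ⟨RingQuot.liftAlgHom k ⟨FreeAlgebra.lift k (Gen.values X Y Z), h⟩, ?_, ?_, ?_⟩ <;>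
    simp [generatorClass, Gen.values]

theorem exists_firstLift (hXY : X * Y = 0) (hYZ : Y * Z = 0) (hXZ : X * Z = Z * X) :
    ∃ φ : RingQuot (FirstRel k) →ₐ[k] D, φ (generatorClass _ Gen.x) = X ∧
      φ (generatorClass _ Gen.y) = Y ∧ φ (generatorClass _ Gen.z) = Z := by
  refine exists_presentationLift fun a b h => ?_
  cases h <;> simpa [Gen.values]

theorem exists_secondLift (hYZ : Y * Z = 0) (hXZ : X * Z = Z * X) :
    ∃ φ : RingQuot (SecondRel k) →ₐ[k] D, φ (generatorClass _ Gen.x) = X ∧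
      φ (generatorClass _ Gen.y) = Y ∧ φ (generatorClass _ Gen.z) = Z := by
  refine exists_presentationLift fun a b h => ?_
  cases h <;> simpa [Gen.values]

/-- A map from the opposite algebra to `D` is a map from the algebra to `Dᵐᵒᵖ`, so each relation is
imposed on `D` in reversed order. -/
theorem exists_firstLift_op (hYX : Y * X = 0) (hZY : Z * Y = 0) (hZX : Z * X = X * Z) :
    ∃ φ : (RingQuot (FirstRel k))ᵐᵒᵖ →ₐ[k] D, φ (op (generatorClass _ Gen.x)) = X ∧
      φ (op (generatorClass _ Gen.y)) = Y ∧ φ (op (generatorClass _ Gen.z)) = Z := by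
  obtain ⟨φ, hx, hy, hz⟩ := exists_firstLift (k := k) (D := Dᵐᵒᵖ) (X := op X) (Y := op Y)
    (Z := op Z) (congrArg op hYX) (congrArg op hZY) (congrArg op hZX)
  exact ⟨AlgHom.opComm φ, congrArg unop hx, congrArg unop hy, congrArg unop hz⟩

theorem exists_secondLift_op (hZY : Z * Y = 0) (hZX : Z * X = X * Z) :
    ∃ φ : (RingQuot (SecondRel k))ᵐᵒᵖ →ₐ[k] D, φ (op (generatorClass _ Gen.x)) = X ∧
      φ (op (generatorClass _ Gen.y)) = Y ∧ φ (op (generatorClass _ Gen.z)) = Z := by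
  obtain ⟨φ, hx, hy, hz⟩ := exists_secondLift (k := k) (D := Dᵐᵒᵖ) (X := op X) (Y := op Y)
    (Z := op Z) (congrArg op hZY) (congrArg op hZX)
  exact ⟨AlgHom.opComm φ, congrArg unop hx, congrArg unop hy, congrArg unop hz⟩

theorem generatorClass_mul_eq_zero {i j : Gen}
    (h : r (FreeAlgebra.ι k i * FreeAlgebra.ι k j) 0) :
    generatorClass r i * generatorClass r j = 0 := by
  have e := RingQuot.mkAlgHom_rel k h
  rwa [map_mul, map_zero] at e

theorem generatorClass_mul_eq_mul {i j i' j' : Gen}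
    (h : r (FreeAlgebra.ι k i * FreeAlgebra.ι k j) (FreeAlgebra.ι k i' * FreeAlgebra.ι k j')) :
    generatorClass r i * generatorClass r j = generatorClass r i' * generatorClass r j' := by
  have e := RingQuot.mkAlgHom_rel k h
  rwa [map_mul, map_mul] at e

end Presentations

/-! ### The two algebras -/

section Main

open Polynomial MulOpposite

variable (k : Type*) [Field k]

theorem diag_mul_offDiag_eq_zero : !![0, 0; 0, (X : k[X])] * !![0, 1; 0, 0] = 0 := by
  ext i j
  fin_cases i <;> fin_cases j <;> simp [Matrix.mul_apply]

theorem first_not_isGradedLeftCoherent : ¬ IsGradedLeftCoherent (wordGrading (FirstRel k)) := by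
  obtain ⟨ρ, hρx, hρy, hρz⟩ := exists_firstLift (k := k) (X := !![0, 0; 0, (X : k[X])])
    (Y := !![0, 1; 0, 0]) (Z := 0) (diag_mul_offDiag_eq_zero k) (by simp) (by simp)
  obtain ⟨φ, hφx, hφy, hφz⟩ := exists_firstLift (k := k) (X := C (X : k[X]))
    (Y := 0) (Z := X) (by simp) (by simp) (mul_comm _ _)
  exact not_isGradedLeftCoherent_of_representations
    (exists_algebraMap_eq_of_mem_wordGrading_zero _) (exists_left_mul_generators _)
    (generatorClass_mem _ _) (generatorClass_mul_eq_mul FirstRel.xz)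
    (generatorClass_mul_eq_zero FirstRel.yz) ρ hρx hρy hρz φ hφx hφy hφz

/-- The presentation is symmetric under reversing products and exchanging `x` with `z`, so `x` now
plays the role of `z`. -/
theorem first_not_isGradedRightCoherent : ¬ IsGradedRightCoherent (wordGrading (FirstRel k)) := by
  obtain ⟨ρ, hρx, hρy, hρz⟩ := exists_firstLift_op (k := k) (X := 0)
    (Y := !![0, 1; 0, 0]) (Z := !![0, 0; 0, (X : k[X])]) (by simp)
    (diag_mul_offDiag_eq_zero k) (by simp)
  obtain ⟨φ, hφx, hφy, hφz⟩ := exists_firstLift_op (k := k) (X := X)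
    (Y := 0) (Z := C (X : k[X])) (by simp) (by simp) (mul_comm _ _)
  refine not_isGradedLeftCoherent_of_representations (x := op (generatorClass _ Gen.z))
    (y := op (generatorClass _ Gen.y)) (z := op (generatorClass _ Gen.x))
    (exists_algebraMap_eq_of_mem_opGrading_zero _) (fun n a ha => ?_)
    (generatorClass_mem _ Gen.x) (congrArg op (generatorClass_mul_eq_mul FirstRel.xz))
    (congrArg op (generatorClass_mul_eq_zero FirstRel.xy)) ρ hρz hρy hρx φ hφz hφy hφx
  obtain ⟨b, hb, c, hc, e, he, rfl⟩ := exists_op_left_mul_generators _ n a ha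
  exact ⟨e, he, c, hc, b, hb, by abel⟩

theorem second_not_isGradedLeftCoherent : ¬ IsGradedLeftCoherent (wordGrading (SecondRel k)) := by
  obtain ⟨ρ, hρx, hρy, hρz⟩ := exists_secondLift (k := k) (X := !![0, 0; 0, (X : k[X])])
    (Y := !![0, 1; 0, 0]) (Z := 0) (by simp) (by simp)
  obtain ⟨φ, hφx, hφy, hφz⟩ := exists_secondLift (k := k) (X := C (X : k[X]))
    (Y := 0) (Z := X) (by simp) (mul_comm _ _)
  exact not_isGradedLeftCoherent_of_representations
    (exists_algebraMap_eq_of_mem_wordGrading_zero _) (exists_left_mul_generators _)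
    (generatorClass_mem _ _) (generatorClass_mul_eq_mul SecondRel.xz)
    (generatorClass_mul_eq_zero SecondRel.yz) ρ hρx hρy hρz φ hφx hφy hφz

theorem second_isGradedRightCoherent : IsGradedRightCoherent (wordGrading (SecondRel k)) := by
  have hzy : op (generatorClass (SecondRel k) Gen.z) * op (generatorClass (SecondRel k) Gen.y) = 0 :=
    congrArg op (generatorClass_mul_eq_zero SecondRel.yz)
  have hzx : op (generatorClass (SecondRel k) Gen.z) * op (generatorClass (SecondRel k) Gen.x) =
      op (generatorClass (SecondRel k) Gen.x) * op (generatorClass (SecondRel k) Gen.z) :=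
    congrArg op (generatorClass_mul_eq_mul SecondRel.xz)
  generalize hx : op (generatorClass (SecondRel k) Gen.x) = x at hzx
  generalize hy : op (generatorClass (SecondRel k) Gen.y) = y at hzy
  generalize hz : op (generatorClass (SecondRel k) Gen.z) = z at hzx hzy
  -- The matrices encode left division by `x` and `y`; the diagonal entry `z` in row 1 reflects that
  -- `z` commutes with `x`.
  obtain ⟨D, hDx, hDy, hDz⟩ := exists_secondLift_op (k := k) (X := !![x, 0, 0; 1, 0, 0; 0, 0, 0])
    (Y := !![y, 0, 0; 0, 0, 0; 1, 0, 0]) (Z := !![z, 0, 0; 0, z, 0; 0, 0, 0])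
    (by ext i j; fin_cases i <;> fin_cases j <;> simp [Matrix.mul_apply, Fin.sum_univ_three, hzy])
    (by ext i j; fin_cases i <;> fin_cases j <;> simp [Matrix.mul_apply, Fin.sum_univ_three, hzx])
  subst hx hy hz
  exact isGradedLeftCoherent_of_matrix_action (exists_algebraMap_eq_of_mem_opGrading_zero _)
    (exists_op_left_mul_generators _) (generatorClass_mem _ _) (generatorClass_mem _ _)
    (generatorClass_mem _ _) hzx hzy D hDx hDy hDz

end Main

theorem mainTheorem11 (k : Type*) [Field k] :
    (¬ IsGradedLeftCoherent (wordGrading (FirstRel k)) ∧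
      ¬ IsGradedRightCoherent (wordGrading (FirstRel k))) ∧
    (IsGradedRightCoherent (wordGrading (SecondRel k)) ∧
      ¬ IsGradedLeftCoherent (wordGrading (SecondRel k))) :=
  ⟨⟨first_not_isGradedLeftCoherent k, first_not_isGradedRightCoherent k⟩,
    second_isGradedRightCoherent k, second_not_isGradedLeftCoherent k⟩
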